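/- **Theorem 1.** For $(u,v)\in\mathbb R^2$ let $$C(u,v)=\tfrac{\sqrt2}{2}\big(\cos(-u+v),\sin(-u+v),\cos(u+v),\sin(u+v)\big),\qquad N(u,v)=\tfrac{\sqrt2}{2}\big(\cos(-u+v),\sin(-u+v),-\cos(u+v),-\sin(u+v)\big)$$ be the parametrization of the Clifford torus in $\mathbb S^3\subset\mathbb R^4$ and its unit normal in $\mathbb S^3$, let $h(u,v)=\sin^2(2v-2u)$, and for $\varepsilon\in\mathbb R$ put $$\alpha_\varepsilon(u,v)=\frac{C(u,v)+\varepsilon\,h(u,v)N(u,v)}{|C(u,v)+\varepsilon\,h(u,v)N(u,v)|}.$$ Let $\mathbb T^2=\mathbb S^1\times\mathbb S^1$. For every $\delta>0$ there are an $\varepsilon\neq0$ with $|\varepsilon|<\delta$ and a $C^\infty$ embedding $\alpha:\mathbb T^2\to\mathbb S^3$ with $\alpha\big(e^{i(-u+v)},e^{i(u+v)}\big)=\alpha_\varepsilon(u,v)$ for all $u,v$, such that the following hold. 1. Every point of $\mathbb T^2$ is hyperbolic for $\alpha$, that is, the extrinsic Gaussian curvature $\det(DN_\alpha)$, where $N_\alpha$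 is the unit normal of $\alpha$ in $\mathbb S^3$, is negative everywhere. 2. Let $\mathcal A_{\alpha,1},\mathcal A_{\alpha,2}$ be the two asymptotic foliations, i.e. the integral foliations of the two line fields on which the second fundamental form of $\alpha$ in $\mathbb S^3$ vanishes. Then for $i=1,2$ a leaf of $\mathcal A_{\alpha,i}$, parametrized by arc length on all of $\mathbb R$, passes through every point of $\mathbb T^2$, and every leaf $\gamma$ of $\mathcal A_{\alpha,i}$ is dense in $\mathbb T^2$; moreover $L(\gamma)=\mathbb T^2$, where the limit set $L(\gamma)$ is the union of the $\alpha$-limit set and the $\omega$-limit set of $\gamma$. -/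

import Mathlib

open scoped Manifold ContDiff
open Filter Topology

noncomputable section

/-- Euclidean space `ℝ⁴` with its canonical inner product. -/
abbrev E4 : Type := EuclideanSpace ℝ (Fin 4)

/-- The unit sphere `S³` of `ℝ⁴`. -/
abbrev S3 : Type := Metric.sphere (0 : E4) 1

/-- The torus `T² = S¹ × S¹`. -/
abbrev Torus : Type := Circle × Circle

/-- A smooth (`C^∞`) embedding of the torus in `S³`: a smooth map with injective differential
at every point that is a homeomorphism onto its image. -/
structure IsTorusEmbedding (α : Torus → S3) : Prop where
  smooth : ContMDiff ((𝓡 1).prod (𝓡 1)) (𝓡 3) ∞ α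
  immersion : ∀ p, Function.Injective (mfderiv ((𝓡 1).prod (𝓡 1)) (𝓡 3) α p)
  embedding : IsEmbedding α

/-- The universal covering `ℝ² → T²`, `(x, y) ↦ (e^{ix}, e^{iy})`. Its restrictions to small open
sets are the inverses of (oriented) charts of the torus. -/
def cover (q : ℝ × ℝ) : Torus := (Circle.exp q.1, Circle.exp q.2)

namespace TorusMap

variable (α : Torus → S3)

/-- The map `α` in the coordinates `(x, y)`, with values in `ℝ⁴`. -/
def coord (x y : ℝ) : E4 := (α (cover (x, y)) : E4)

/-- Partial derivatives of `α` in the coordinates `(x, y)`. -/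
def dx (x y : ℝ) : E4 := deriv (fun s => coord α s y) x
def dy (x y : ℝ) : E4 := deriv (fun s => coord α x s) y
def dxx (x y : ℝ) : E4 := deriv (fun s => dx α s y) x
def dxy (x y : ℝ) : E4 := deriv (fun s => dx α x s) y
def dyy (x y : ℝ) : E4 := deriv (fun s => dy α x s) y

/-- Coefficients of the first fundamental form. -/
def formE (q : ℝ × ℝ) : ℝ := inner ℝ (dx α q.1 q.2) (dx α q.1 q.2)
def formF (q : ℝ × ℝ) : ℝ := inner ℝ (dx α q.1 q.2) (dy α q.1 q.2)
def formG (q : ℝ × ℝ) : ℝ := inner ℝ (dy α q.1 q.2) (dy α q.1 q.2)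

/-- The determinant of four vectors of `ℝ⁴`. -/
def det4 (a b c d : E4) : ℝ := Matrix.det (Matrix.of fun i j : Fin 4 => (![a, b, c, d] i) j)

/-- The normal component of `w`: the inner product of `w` with the unit normal
`α ∧ α_x ∧ α_y / |α ∧ α_x ∧ α_y|` of `α` in `S³`. -/
def normalPart (q : ℝ × ℝ) (w : E4) : ℝ :=
  det4 (coord α q.1 q.2) (dx α q.1 q.2) (dy α q.1 q.2) w /
    √(formE α q * formG α q - formF α q ^ 2)

/-- Coefficients of the second fundamental form `II = e dx² + 2 f dx dy + g dy²`. -/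
def forme (q : ℝ × ℝ) : ℝ := normalPart α q (dxx α q.1 q.2)
def formf (q : ℝ × ℝ) : ℝ := normalPart α q (dxy α q.1 q.2)
def formg (q : ℝ × ℝ) : ℝ := normalPart α q (dyy α q.1 q.2)

/-- The second fundamental form on the tangent vector `w`. -/
def secondForm (q w : ℝ × ℝ) : ℝ :=
  forme α q * w.1 ^ 2 + 2 * formf α q * w.1 * w.2 + formg α q * w.2 ^ 2

/-- The extrinsic Gaussian curvature. -/
def curvExt (q : ℝ × ℝ) : ℝ :=
  (forme α q * formg α q - formf α q ^ 2) / (formE α q * formG α q - formF α q ^ 2)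

/-- The point of the torus with coordinates `q` lies in the hyperbolic region. -/
def IsHyperbolic (q : ℝ × ℝ) : Prop := curvExt α q < 0

/-- The square root of the discriminant of `II`. -/
def disc (q : ℝ × ℝ) : ℝ := √(formf α q ^ 2 - forme α q * formg α q)

/-- The sign that distinguishes the two asymptotic line fields. -/
def lineSign (i : Fin 2) : ℝ := ![-1, 1] i

/-- The two asymptotic line fields on the hyperbolic region, `i = 0` being the first one and
`i = 1` the second one. With `D = √(f² - e g) > 0` and `σ = ∓1`, the two one-forms
`e dx + (f + σ D) dy` and `(f - σ D) dx + g dy` are proportional and do not both vanish; their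
common kernel is the line. The lines for `σ = -1` and `σ = 1` are distinct and their union is the
null cone of `II`. -/
def asymptoticLine (i : Fin 2) (q : ℝ × ℝ) : Set (ℝ × ℝ) :=
  {w | forme α q * w.1 + (formf α q + lineSign i * disc α q) * w.2 = 0 ∧
    (formf α q - lineSign i * disc α q) * w.1 + formg α q * w.2 = 0}

/-- A complete asymptotic line of the `i`-th asymptotic foliation parametrized by arc length
(given through a lift `c` to the universal covering). On a compact surface that is hyperbolic
everywhere, the leaves of the foliation are exactly the images `Set.range (cover ∘ c)`
of these curves. -/
structure IsAsymptoticLine (i : Fin 2) (c : ℝ → ℝ × ℝ) : Prop where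
  contDiff : ContDiff ℝ 1 c
  hyperbolic : ∀ t, IsHyperbolic α (c t)
  tangent : ∀ t, deriv c t ∈ asymptoticLine α i (c t)
  arclength : ∀ t, ‖deriv (fun s => coord α (c s).1 (c s).2) t‖ = 1

/-- The limit set of a curve in the torus: the union of its `α`-limit set and its `ω`-limit set,
that is, of the cluster points of `γ t` for `t → -∞` and for `t → +∞`. -/
def limitSet (γ : ℝ → Torus) : Set Torus :=
  {p | MapClusterPt p atBot γ} ∪ {p | MapClusterPt p atTop γ}

end TorusMap

namespace Clifford

/-- The parametrization of the Clifford torus. -/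
def C (u v : ℝ) : E4 :=
  (√2 / 2) • !₂[Real.cos (-u + v), Real.sin (-u + v), Real.cos (u + v), Real.sin (u + v)]

/-- The unit normal of the Clifford torus in `S³`. -/
def N (u v : ℝ) : E4 :=
  (√2 / 2) • !₂[Real.cos (-u + v), Real.sin (-u + v), -Real.cos (u + v), -Real.sin (u + v)]

/-- The profile of the normal deformation. -/
def h (u v : ℝ) : ℝ := Real.sin (2 * v - 2 * u) ^ 2

/-- The normal deformation `α_ε = (C + ε h N) / |C + ε h N|`. -/
def deformation (ε u v : ℝ) : E4 :=
  ‖C u v + (ε * h u v) • N u v‖⁻¹ • (C u v + (ε * h u v) • N u v)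

end Clifford

end

/-!
In the coordinates `x = v - u`, `y = v + u` the deformed torus is the radial normalization of
`(e^{ix}, q(x) e^{iy})`, where `q = (1 - ε h) / (1 + ε h)`. Its second fundamental form is a
multiple of `q dy² - (q'' + q) dx²`, so the asymptotic lines are the graphs `dy = ± m dx` with
`m = √((q'' + q) / q)`, all of them translates of one another in `y`. They are dense, with full
limit set, as soon as the rotation number `(1 / 2π) ∫₀^{2π} m` is irrational. This number is
continuous in `ε` and equals `1` at `ε = 0`. The AM-GM inequality
`2 m ≤ q² m² + q⁻² = q q'' + q² + q⁻²` together with `∫ q q'' = -∫ q'²` shows that it is less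
than `1` once `∫ (q - q⁻¹)² < ∫ q'²`, which holds for all small `ε > 0`; hence it takes irrational
values for arbitrarily small `ε`.
-/

noncomputable section

open Real

section IrrationalRotation

theorem denseRange_exp_zpow {ρ : ℝ} (hρ : Irrational ρ) :
    DenseRange (fun n : ℤ => Circle.exp (2 * π * ρ) ^ n) := by
  have hmul : Irrational (2 * π * ρ / (2 * π)) := by rwa [mul_div_cancel_left₀ _ two_pi_pos.ne']
  have hdense := AddCircle.homeomorphCircle'.surjective.denseRange.comp
    (AddCircle.denseRange_zsmul_coe_iff.2 hmul) AddCircle.homeomorphCircle'.continuous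
  refine hdense.mono (Set.range_subset_range_iff_exists_comp.2 ⟨id, funext fun n => ?_⟩)
  rw [Function.comp_apply, ← AddCircle.coe_zsmul, AddCircle.homeomorphCircle'_apply_mk,
    zsmul_eq_mul, Circle.exp_intCast_mul, Function.comp_apply, id]

theorem mapClusterPt_exp_pow {ρ : ℝ} (hρ : Irrational ρ) (z : Circle) :
    MapClusterPt z atTop (fun n : ℕ => Circle.exp (2 * π * ρ) ^ n) := by
  rw [mapClusterPt_atTop_pow_iff_mem_topologicalClosure_zpowers]
  exact denseRange_exp_zpow hρ z

/-- The rotation number of the flow `dy/dx = m x` on the torus, for a `2π`-periodic slope `m`: the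
first return map to a circle `x = const` is the rotation by the angle `2π * rotationNumber m`. -/
def rotationNumber (m : ℝ → ℝ) : ℝ := (∫ x in 0..2 * π, m x) / (2 * π)

theorem rotationNumber_const_mul (a : ℝ) (m : ℝ → ℝ) :
    rotationNumber (fun x => a * m x) = a * rotationNumber m := by
  rw [rotationNumber, rotationNumber, intervalIntegral.integral_const_mul, mul_div_assoc]

theorem integral_add_natCast_mul_two_pi {m : ℝ → ℝ} (hm : Continuous m)
    (hmp : Function.Periodic m (2 * π)) (s : ℝ) (n : ℕ) :
    ∫ x in 0..s + n * (2 * π), m x = (∫ x in 0..s, m x) + n * (2 * π * rotationNumber m) := by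
  have hperiods := hmp.intervalIntegral_add_zsmul_eq n s hm.intervalIntegrable
  rw [hmp.intervalIntegral_add_eq s 0, zero_add] at hperiods
  simp only [zsmul_eq_mul, Int.cast_natCast] at hperiods
  rw [← intervalIntegral.integral_add_adjacent_intervals (hm.intervalIntegrable 0 s)
    (hm.intervalIntegrable s _), hperiods, rotationNumber, mul_div_cancel₀ _ two_pi_pos.ne']

theorem mapClusterPt_cover_of_graph {m : ℝ → ℝ} (hm : Continuous m)
    (hmp : Function.Periodic m (2 * π)) (hρ : Irrational (rotationNumber m)) {c : ℝ → ℝ × ℝ}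
    {y₀ : ℝ} (hc : ∀ t, (c t).2 = y₀ + ∫ x in 0..(c t).1, m x) {p : Torus} {τ : ℕ → ℝ}
    {l : Filter ℝ} (hτ : Tendsto τ atTop l)
    (hcτ : ∀ n, (c (τ n)).1 = Complex.arg p.1 + n * (2 * π)) : MapClusterPt p l (cover ∘ c) := by
  set a := Circle.exp (y₀ + ∫ x in 0..Complex.arg p.1, m x)
  have horbit : (cover ∘ c) ∘ τ =
      (fun z => (p.1, a * z)) ∘ fun n => Circle.exp (2 * π * rotationNumber m) ^ n := by
    funext n
    simp only [Function.comp_apply, cover, hc, hcτ, integral_add_natCast_mul_two_pi hm hmp,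
      ← add_assoc, Circle.exp_add, Circle.exp_natCast_mul, Circle.exp_two_pi, one_pow, mul_one,
      Circle.exp_arg, a]
  have hcont : ContinuousAt (fun z : Circle => (p.1, a * z)) (a⁻¹ * p.2) := by fun_prop
  have hcluster := (mapClusterPt_exp_pow hρ (a⁻¹ * p.2)).continuousAt_comp hcont
  rw [mul_inv_cancel_left, ← horbit] at hcluster
  exact hcluster.of_comp hτ

end IrrationalRotation

section GraphsOnTheTorus

theorem exists_orderIso_hasDerivAt {l : ℝ → ℝ} (hl : Continuous l) {T : ℝ} (hT : 0 < T)
    (hlp : Function.Periodic l T) (hpos : ∀ x, 0 < l x) :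
    ∃ L : ℝ ≃o ℝ, ∀ x, HasDerivAt L (l x) x := by
  have hderiv : ∀ x, HasDerivAt (fun x => ∫ z in 0..x, l z) (l x) x :=
    fun x => (hl.integral_hasStrictDerivAt 0 x).hasDerivAt
  have hsurj : Function.Surjective fun x => ∫ z in 0..x, l z :=
    (continuous_iff_continuousAt.2 fun x => (hderiv x).continuousAt).surjective
      (hlp.tendsto_atTop_intervalIntegral_of_pos' (hl.intervalIntegrable 0 T) hpos hT)
      (hlp.tendsto_atBot_intervalIntegral_of_pos' (hl.intervalIntegrable 0 T) hpos hT)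
  exact ⟨(strictMono_of_hasDerivAt_pos hderiv hpos).orderIsoOfSurjective _ hsurj, hderiv⟩

theorem hasDerivAt_orderIso_symm {L : ℝ ≃o ℝ} {l t : ℝ} (hL : HasDerivAt L l (L.symm t))
    (hl : l ≠ 0) : HasDerivAt L.symm l⁻¹ t :=
  hL.of_local_left_inverse L.symm.continuous.continuousAt hl
    (Eventually.of_forall L.apply_symm_apply)

theorem hasDerivAt_fst {E F : Type*} [NormedAddCommGroup E] [NormedSpace ℝ E]
    [NormedAddCommGroup F] [NormedSpace ℝ F] {c : ℝ → E × F} {c' : E × F} {t : ℝ}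
    (hc : HasDerivAt c c' t) : HasDerivAt (fun s => (c s).1) c'.1 t :=
  (ContinuousLinearMap.fst ℝ E F).hasFDerivAt.comp_hasDerivAt t hc

theorem hasDerivAt_snd {E F : Type*} [NormedAddCommGroup E] [NormedSpace ℝ E]
    [NormedAddCommGroup F] [NormedSpace ℝ F] {c : ℝ → E × F} {c' : E × F} {t : ℝ}
    (hc : HasDerivAt c c' t) : HasDerivAt (fun s => (c s).2) c'.2 t :=
  (ContinuousLinearMap.snd ℝ E F).hasFDerivAt.comp_hasDerivAt t hc

theorem comp_eq_add_or_eq_sub_of_arclength {L l x : ℝ → ℝ} (hL : ∀ x, HasDerivAt L (l x) x)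
    (hl : Continuous l) (hpos : ∀ x, 0 < l x) (hx : ContDiff ℝ 1 x)
    (hspeed : ∀ t, l (x t) * |deriv x t| = 1) :
    (∀ t, L (x t) = L (x 0) + t) ∨ ∀ t, L (x t) = L (x 0) - t := by
  have hderiv (t : ℝ) : HasDerivAt (L ∘ x) (l (x t) * deriv x t) t :=
    (hL (x t)).comp t (hx.differentiable one_ne_zero t).hasDerivAt
  have hsq : Set.EqOn ((fun t => l (x t) * deriv x t) ^ 2) 1 Set.univ := fun t _ => by
    rw [Pi.pow_apply, ← sq_abs, abs_mul, abs_of_pos (hpos _), hspeed, one_pow, Pi.one_apply]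
  have hcont : Continuous fun t => l (x t) * deriv x t :=
    (hl.comp hx.continuous).mul (hx.continuous_deriv le_rfl)
  refine (isPreconnected_univ.eq_one_or_eq_neg_one_of_sq_eq hcont.continuousOn hsq).imp
    (fun hone t => ?_) fun hneg t => ?_
  · have hzero (s : ℝ) : HasDerivAt (fun s => L (x s) - s) 0 s :=
      ((hderiv s).sub (hasDerivAt_id s)).congr_deriv (sub_eq_zero.2 (hone (Set.mem_univ s)))
    linarith [is_const_of_deriv_eq_zero (fun s => (hzero s).differentiableAt)
      (fun s => (hzero s).deriv) t 0]
  · have hzero (s : ℝ) : HasDerivAt (fun s => L (x s) + s) 0 s :=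
      ((hderiv s).add (hasDerivAt_id s)).congr_deriv
        (add_eq_zero_iff_eq_neg.2 (hneg (Set.mem_univ s)))
    linarith [is_const_of_deriv_eq_zero (fun s => (hzero s).differentiableAt)
      (fun s => (hzero s).deriv) t 0]

/-- A curve with `dy/dx = m x` in the plane, parametrized by arc length for the line element
`l x * |dx|`. -/
structure IsArclengthGraph (m l : ℝ → ℝ) (c : ℝ → ℝ × ℝ) : Prop where
  contDiff : ContDiff ℝ 1 c
  slope : ∀ t, (deriv c t).2 = m (c t).1 * (deriv c t).1
  speed : ∀ t, l (c t).1 * |(deriv c t).1| = 1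

namespace IsArclengthGraph

variable {m l : ℝ → ℝ} {c : ℝ → ℝ × ℝ}

theorem hasDerivAt (hc : IsArclengthGraph m l c) (t : ℝ) : HasDerivAt c (deriv c t) t :=
  (hc.contDiff.differentiable one_ne_zero t).hasDerivAt

theorem snd_eq_add_integral (hc : IsArclengthGraph m l c) (hm : Continuous m) (t : ℝ) :
    (c t).2 = ((c 0).2 - ∫ z in 0..(c 0).1, m z) + ∫ z in 0..(c t).1, m z := by
  have hintegral (s : ℝ) : HasDerivAt (fun s => ∫ z in 0..(c s).1, m z)
      (m (c s).1 * (deriv c s).1) s :=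
    HasDerivAt.comp (h₂ := fun x => ∫ z in 0..x, m z) s
      (hm.integral_hasStrictDerivAt 0 (c s).1).hasDerivAt (hasDerivAt_fst (hc.hasDerivAt s))
  have hzero (s : ℝ) : HasDerivAt (fun s => (c s).2 - ∫ z in 0..(c s).1, m z) 0 s :=
    ((hasDerivAt_snd (hc.hasDerivAt s)).sub (hintegral s)).congr_deriv
      (sub_eq_zero.2 (hc.slope s))
  linarith [is_const_of_deriv_eq_zero (fun s => (hzero s).differentiableAt)
    (fun s => (hzero s).deriv) t 0]

theorem limitSet_eq_univ (hc : IsArclengthGraph m l c) (hm : Continuous m)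
    (hmp : Function.Periodic m (2 * π)) (hρ : Irrational (rotationNumber m)) (hl : Continuous l)
    (hlp : Function.Periodic l (2 * π)) (hpos : ∀ x, 0 < l x) :
    TorusMap.limitSet (cover ∘ c) = Set.univ := by
  refine Set.eq_univ_of_forall fun p => ?_
  obtain ⟨L, hL⟩ := exists_orderIso_hasDerivAt hl two_pi_pos hlp hpos
  have hcluster {τ : ℕ → ℝ} {f : Filter ℝ} (hτ : Tendsto τ atTop f)
      (hcτ : ∀ n, L (c (τ n)).1 = L (Complex.arg p.1 + n * (2 * π))) :
      MapClusterPt p f (cover ∘ c) :=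
    mapClusterPt_cover_of_graph hm hmp hρ (hc.snd_eq_add_integral hm) hτ
      fun n => L.injective (hcτ n)
  have hL_top : Tendsto (fun n : ℕ => L (Complex.arg p.1 + n * (2 * π))) atTop atTop :=
    L.tendsto_atTop.comp <| tendsto_atTop_add_const_left _ _ <|
      tendsto_natCast_atTop_atTop.atTop_mul_const two_pi_pos
  have hspeed (t : ℝ) : l (c t).1 * |deriv (fun s => (c s).1) t| = 1 := by
    rw [(hasDerivAt_fst (hc.hasDerivAt t)).deriv, hc.speed]
  rcases comp_eq_add_or_eq_sub_of_arclength hL hl hpos hc.contDiff.fst hspeed with hadd | hsub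
  · refine Or.inr (hcluster (tendsto_atTop_add_const_left _ (-L (c 0).1) hL_top) fun n => ?_)
    rw [hadd, add_neg_cancel_left]
  · refine Or.inl (hcluster (tendsto_atBot_add_const_left _ (L (c 0).1)
      (tendsto_neg_atTop_atBot.comp hL_top)) fun n => ?_)
    rw [hsub, Function.comp_apply, sub_add_cancel_left, neg_neg]

theorem exists_of_periodic (hm : Continuous m) (hl : Continuous l) {T : ℝ} (hT : 0 < T)
    (hlp : Function.Periodic l T) (hpos : ∀ x, 0 < l x) (z : ℝ × ℝ) :
    ∃ c, IsArclengthGraph m l c ∧ c 0 = z := by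
  obtain ⟨L, hL⟩ := exists_orderIso_hasDerivAt hl hT hlp hpos
  set x : ℝ → ℝ := fun t => L.symm (L z.1 + t)
  set y : ℝ → ℝ := fun t => z.2 + ∫ s in z.1..x t, m s
  have hx (t : ℝ) : HasDerivAt x (l (x t))⁻¹ t :=
    (hasDerivAt_orderIso_symm (hL _) (hpos _).ne').comp_const_add (L z.1) t
  have hy (t : ℝ) : HasDerivAt y (m (x t) * (l (x t))⁻¹) t :=
    ((hm.integral_hasStrictDerivAt z.1 (x t)).hasDerivAt.comp t (hx t)).const_add z.2
  have hxy (t : ℝ) : deriv (fun t => (x t, y t)) t = ((l (x t))⁻¹, m (x t) * (l (x t))⁻¹) :=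
    ((hx t).prodMk (hy t)).deriv
  have hxc : Continuous x := continuous_iff_continuousAt.2 fun t => (hx t).continuousAt
  have hinv : Continuous fun t => (l (x t))⁻¹ := (hl.comp hxc).inv₀ fun t => (hpos _).ne'
  refine ⟨fun t => (x t, y t), ⟨contDiff_one_iff_deriv.2
    ⟨fun t => ((hx t).prodMk (hy t)).differentiableAt, ?_⟩, fun t => ?_, fun t => ?_⟩, ?_⟩
  · rw [funext hxy]
    exact hinv.prodMk ((hm.comp hxc).mul hinv)
  · rw [hxy]
  · rw [hxy, abs_of_pos (inv_pos.2 (hpos _)), mul_inv_cancel₀ (hpos _).ne']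
  · simp [x, y]

end IsArclengthGraph

theorem dense_range_of_limitSet_eq_univ {γ : ℝ → Torus} (h : TorusMap.limitSet γ = Set.univ) :
    Dense (Set.range γ) := fun p => by
  refine mem_closure_iff_nhds.2 fun U hU => ?_
  obtain hp | hp : p ∈ TorusMap.limitSet γ := h ▸ Set.mem_univ p
  all_goals
    obtain ⟨t, ht⟩ := (hp.frequently hU).exists
    exact ⟨γ t, ht, t, rfl⟩

end GraphsOnTheTorus

section AsymptoticSlope

theorem hasDerivAt_deriv_of_contDiff {f : ℝ → ℝ} (hf : ContDiff ℝ 2 f) (x : ℝ) :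
    HasDerivAt (deriv f) (deriv (deriv f) x) x :=
  (hf.deriv'.differentiable one_ne_zero x).hasDerivAt

theorem continuous_deriv_deriv_of_contDiff {f : ℝ → ℝ} (hf : ContDiff ℝ 2 f) :
    Continuous (deriv (deriv f)) :=
  hf.deriv'.continuous_deriv_one

theorem periodic_deriv {f : ℝ → ℝ} {T : ℝ} (hf : Function.Periodic f T) :
    Function.Periodic (deriv f) T := fun x => by
  rw [← deriv_comp_add_const, hf.funext]

theorem integral_mul_deriv_deriv_of_periodic {f : ℝ → ℝ} (hf : ContDiff ℝ 2 f) {T : ℝ}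
    (hT : Function.Periodic f T) :
    ∫ x in 0..T, f x * deriv (deriv f) x = -∫ x in 0..T, deriv f x ^ 2 := by
  have hparts := intervalIntegral.integral_mul_deriv_eq_deriv_mul (a := 0) (b := T)
    (fun x _ => (hf.differentiable two_ne_zero x).hasDerivAt)
    (fun x _ => hasDerivAt_deriv_of_contDiff hf x)
    (hf.continuous_deriv one_le_two |>.intervalIntegrable 0 T)
    ((continuous_deriv_deriv_of_contDiff hf).intervalIntegrable 0 T)
  rw [hT.eq, (periodic_deriv hT).eq, sub_self, zero_sub] at hparts
  simpa only [sq] using hparts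

/-- The slope `|dy/dx|` of the asymptotic lines of the torus of rotation with profile `q`. -/
def asymptoticSlope (q : ℝ → ℝ) (x : ℝ) : ℝ := √((deriv (deriv q) x + q x) / q x)

/-- The profiles `q` for which the torus `(e^{ix}, q(x) e^{iy})`, normalized to the unit sphere, is
hyperbolic everywhere. -/
structure IsHyperbolicProfile (q : ℝ → ℝ) : Prop where
  contDiff : ContDiff ℝ 2 q
  periodic : Function.Periodic q (2 * π)
  pos : ∀ x, 0 < q x
  convex : ∀ x, 0 < deriv (deriv q) x + q x

namespace IsHyperbolicProfile

variable {q : ℝ → ℝ}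

theorem asymptoticSlope_pos (hq : IsHyperbolicProfile q) (x : ℝ) : 0 < asymptoticSlope q x :=
  sqrt_pos.2 (div_pos (hq.convex x) (hq.pos x))

theorem asymptoticSlope_sq (hq : IsHyperbolicProfile q) (x : ℝ) :
    asymptoticSlope q x ^ 2 = (deriv (deriv q) x + q x) / q x :=
  sq_sqrt (div_pos (hq.convex x) (hq.pos x)).le

theorem continuous_asymptoticSlope (hq : IsHyperbolicProfile q) :
    Continuous (asymptoticSlope q) :=
  (((continuous_deriv_deriv_of_contDiff hq.contDiff).add hq.contDiff.continuous).div
    hq.contDiff.continuous fun x => (hq.pos x).ne').sqrt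

theorem periodic_asymptoticSlope (hq : IsHyperbolicProfile q) :
    Function.Periodic (asymptoticSlope q) (2 * π) := fun x => by
  rw [asymptoticSlope, asymptoticSlope, hq.periodic x,
    periodic_deriv (periodic_deriv hq.periodic) x]

-- The weights `q` and `q⁻¹` in AM-GM turn the bound into one that can be integrated by parts.
theorem two_mul_asymptoticSlope_le (hq : IsHyperbolicProfile q) (x : ℝ) :
    2 * asymptoticSlope q x ≤ q x * deriv (deriv q) x + (q x - (q x)⁻¹) ^ 2 + 2 := by
  have hne := (hq.pos x).ne'
  calc 2 * asymptoticSlope q x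
      = 2 * (q x * asymptoticSlope q x) * (q x)⁻¹ := by field_simp
    _ ≤ (q x * asymptoticSlope q x) ^ 2 + (q x)⁻¹ ^ 2 := two_mul_le_add_sq _ _
    _ = q x * deriv (deriv q) x + (q x - (q x)⁻¹) ^ 2 + 2 := by
      rw [mul_pow, hq.asymptoticSlope_sq]
      field_simp
      ring

theorem rotationNumber_lt_one (hq : IsHyperbolicProfile q)
    (hint : ∫ x in 0..2 * π, (q x - (q x)⁻¹) ^ 2 < ∫ x in 0..2 * π, deriv q x ^ 2) :
    rotationNumber (asymptoticSlope q) < 1 := by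
  have hqc := hq.contDiff.continuous
  have hinv : Continuous fun x => (q x)⁻¹ := hqc.inv₀ fun x => (hq.pos x).ne'
  have hsqc : Continuous fun x => (q x - (q x)⁻¹) ^ 2 := (hqc.sub hinv).pow 2
  have hqq : Continuous fun x => q x * deriv (deriv q) x :=
    hqc.mul (continuous_deriv_deriv_of_contDiff hq.contDiff)
  have hsum : Continuous fun x => q x * deriv (deriv q) x + (q x - (q x)⁻¹) ^ 2 := hqq.add hsqc
  have hle : 2 * ∫ x in 0..2 * π, asymptoticSlope q x ≤
      -(∫ x in 0..2 * π, deriv q x ^ 2) + (∫ x in 0..2 * π, (q x - (q x)⁻¹) ^ 2) + 4 * π := by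
    calc 2 * ∫ x in 0..2 * π, asymptoticSlope q x
        = ∫ x in 0..2 * π, 2 * asymptoticSlope q x :=
          (intervalIntegral.integral_const_mul _ _).symm
      _ ≤ ∫ x in 0..2 * π, (q x * deriv (deriv q) x + (q x - (q x)⁻¹) ^ 2 + 2) :=
          intervalIntegral.integral_mono two_pi_pos.le
            ((hq.continuous_asymptoticSlope.const_mul 2).intervalIntegrable _ _)
            ((hsum.add continuous_const).intervalIntegrable _ _) hq.two_mul_asymptoticSlope_le
      _ = _ := by
          rw [intervalIntegral.integral_add (hsum.intervalIntegrable _ _)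
            intervalIntegrable_const, intervalIntegral.integral_add (hqq.intervalIntegrable _ _)
            (hsqc.intervalIntegrable _ _),
            integral_mul_deriv_deriv_of_periodic hq.contDiff hq.periodic,
            intervalIntegral.integral_const, smul_eq_mul]
          ring
  rw [rotationNumber, div_lt_one two_pi_pos]
  linarith

end IsHyperbolicProfile

end AsymptoticSlope

section MovingFrame

/-- The vector of `ℝ⁴ = ℂ²` with coordinates `(p, q, r, s)` in the orthonormal frame
`(e^{ix}, 0), (i e^{ix}, 0), (0, e^{iy}), (0, i e^{iy})`. -/
def movingFrame (x y p q r s : ℝ) : E4 :=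
  !₂[p * cos x - q * sin x, p * sin x + q * cos x, r * cos y - s * sin y, r * sin y + s * cos y]

theorem smul_movingFrame (c x y p q r s : ℝ) :
    c • movingFrame x y p q r s = movingFrame x y (c * p) (c * q) (c * r) (c * s) := by
  ext i
  fin_cases i <;> simp [movingFrame] <;> ring

theorem inner_movingFrame (x y p q r s p' q' r' s' : ℝ) :
    inner ℝ (movingFrame x y p q r s) (movingFrame x y p' q' r' s') =
      p * p' + q * q' + r * r' + s * s' := by
  simp only [movingFrame, PiLp.inner_apply, Fin.sum_univ_four, RCLike.inner_apply, conj_trivial,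
    Matrix.cons_val]
  linear_combination (p * p' + q * q') * sin_sq_add_cos_sq x +
    (r * r' + s * s') * sin_sq_add_cos_sq y

theorem det4_movingFrame (x y p q r s p₁ q₁ r₁ s₁ p₂ q₂ r₂ s₂ p₃ q₃ r₃ s₃ : ℝ) :
    TorusMap.det4 (movingFrame x y p q r s) (movingFrame x y p₁ q₁ r₁ s₁)
      (movingFrame x y p₂ q₂ r₂ s₂) (movingFrame x y p₃ q₃ r₃ s₃) =
    Matrix.det !![p, q, r, s; p₁, q₁, r₁, s₁; p₂, q₂, r₂, s₂; p₃, q₃, r₃, s₃] := by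
  have hrot : Matrix.det !![cos x, sin x, 0, 0; -sin x, cos x, 0, 0; 0, 0, cos y, sin y;
      0, 0, -sin y, cos y] = 1 := by
    simp [Matrix.det_succ_row_zero, Fin.sum_univ_succ, Fin.succAbove]
    linear_combination (sin y ^ 2 + cos y ^ 2) * sin_sq_add_cos_sq x + sin_sq_add_cos_sq y
  rw [TorusMap.det4, ← mul_one (Matrix.det !![p, q, r, s; _, _, _, _; _, _, _, _; _, _, _, _]),
    ← hrot, ← Matrix.det_mul]
  congr 1
  ext i j
  fin_cases i <;> fin_cases j <;>
    simp [movingFrame, Matrix.mul_apply, Fin.sum_univ_four] <;> ring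

theorem hasDerivAt_vec4 {a b c d : ℝ → ℝ} {a' b' c' d' t : ℝ} (ha : HasDerivAt a a' t)
    (hb : HasDerivAt b b' t) (hc : HasDerivAt c c' t) (hd : HasDerivAt d d' t) :
    HasDerivAt (fun s => (!₂[a s, b s, c s, d s] : E4)) !₂[a', b', c', d'] t := by
  have hpi : HasDerivAt (fun s => ![a s, b s, c s, d s]) ![a', b', c', d'] t :=
    hasDerivAt_pi.2 fun i => by fin_cases i <;> assumption
  exact (PiLp.continuousLinearEquiv 2 ℝ
    fun _ : Fin 4 => ℝ).symm.toContinuousLinearMap.hasFDerivAt.comp_hasDerivAt t hpi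

theorem hasDerivAt_movingFrame {x y p q r s : ℝ → ℝ} {x' y' p' q' r' s' t : ℝ}
    (hx : HasDerivAt x x' t) (hy : HasDerivAt y y' t) (hp : HasDerivAt p p' t)
    (hq : HasDerivAt q q' t) (hr : HasDerivAt r r' t) (hs : HasDerivAt s s' t) :
    HasDerivAt (fun t => movingFrame (x t) (y t) (p t) (q t) (r t) (s t))
      (movingFrame (x t) (y t) (p' - q t * x') (q' + p t * x') (r' - s t * y') (s' + r t * y'))
      t := by
  refine hasDerivAt_vec4 (((hp.mul hx.cos).sub (hq.mul hx.sin)).congr_deriv ?_)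
    (((hp.mul hx.sin).add (hq.mul hx.cos)).congr_deriv ?_)
    (((hr.mul hy.cos).sub (hs.mul hy.sin)).congr_deriv ?_)
    (((hr.mul hy.sin).add (hs.mul hy.cos)).congr_deriv ?_) <;> ring

end MovingFrame

open TorusMap

theorem lineSign_sq (i : Fin 2) : lineSign i ^ 2 = 1 := by
  fin_cases i <;> simp [lineSign]

/-- The map `α` is the torus `(x, y) ↦ (a(x) e^{ix}, q(x) a(x) e^{iy})` of `ℂ²` for a positive
radius `a` and a hyperbolic profile `q`. -/
structure IsRotational (α : Torus → S3) (a q : ℝ → ℝ) : Prop where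
  coord_eq : ∀ x y, coord α x y = movingFrame x y (a x) 0 (q x * a x) 0
  contDiff_radius : ContDiff ℝ 2 a
  periodic_radius : Function.Periodic a (2 * π)
  radius_pos : ∀ x, 0 < a x
  profile : IsHyperbolicProfile q

namespace IsRotational

variable {α : Torus → S3} {a q : ℝ → ℝ}

theorem hasDerivAt_radius (H : IsRotational α a q) (x : ℝ) : HasDerivAt a (deriv a x) x :=
  (H.contDiff_radius.differentiable two_ne_zero x).hasDerivAt

theorem hasDerivAt_profile (H : IsRotational α a q) (x : ℝ) : HasDerivAt q (deriv q x) x :=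
  (H.profile.contDiff.differentiable two_ne_zero x).hasDerivAt

theorem hasDerivAt_profile_mul_radius (H : IsRotational α a q) (x : ℝ) :
    HasDerivAt (fun x => q x * a x) (deriv q x * a x + q x * deriv a x) x :=
  (H.hasDerivAt_profile x).mul (H.hasDerivAt_radius x)

theorem dx_eq (H : IsRotational α a q) (x y : ℝ) :
    dx α x y = movingFrame x y (deriv a x) (a x) (deriv q x * a x + q x * deriv a x) 0 := by
  simp only [dx, H.coord_eq]
  refine ((hasDerivAt_movingFrame (hasDerivAt_id x) (hasDerivAt_const x y) (H.hasDerivAt_radius x)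
    (hasDerivAt_const x 0) (H.hasDerivAt_profile_mul_radius x)
    (hasDerivAt_const x 0)).congr_deriv ?_).deriv
  simp

theorem dy_eq (H : IsRotational α a q) (x y : ℝ) :
    dy α x y = movingFrame x y 0 0 0 (q x * a x) := by
  simp only [dy, H.coord_eq]
  refine ((hasDerivAt_movingFrame (hasDerivAt_const y x) (hasDerivAt_id y) (hasDerivAt_const y _)
    (hasDerivAt_const y _) (hasDerivAt_const y _) (hasDerivAt_const y _)).congr_deriv ?_).deriv
  simp

theorem dxx_eq (H : IsRotational α a q) (x y : ℝ) :
    dxx α x y = movingFrame x y (deriv (deriv a) x - a x) (2 * deriv a x)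
      (deriv (deriv q) x * a x + 2 * (deriv q x * deriv a x) + q x * deriv (deriv a) x) 0 := by
  have ha := hasDerivAt_deriv_of_contDiff H.contDiff_radius x
  have hq := hasDerivAt_deriv_of_contDiff H.profile.contDiff x
  simp only [dxx, H.dx_eq]
  refine ((hasDerivAt_movingFrame (hasDerivAt_id x) (hasDerivAt_const x y) ha
    (H.hasDerivAt_radius x) ((hq.mul (H.hasDerivAt_radius x)).add ((H.hasDerivAt_profile x).mul ha))
    (hasDerivAt_const x 0)).congr_deriv ?_).deriv
  simp only [id]
  congr 1 <;> ring

theorem dxy_eq (H : IsRotational α a q) (x y : ℝ) :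
    dxy α x y = movingFrame x y 0 0 0 (deriv q x * a x + q x * deriv a x) := by
  simp only [dxy, H.dx_eq]
  refine ((hasDerivAt_movingFrame (hasDerivAt_const y x) (hasDerivAt_id y) (hasDerivAt_const y _)
    (hasDerivAt_const y _) (hasDerivAt_const y _) (hasDerivAt_const y _)).congr_deriv ?_).deriv
  simp

theorem dyy_eq (H : IsRotational α a q) (x y : ℝ) :
    dyy α x y = movingFrame x y 0 0 (-(q x * a x)) 0 := by
  simp only [dyy, H.dy_eq]
  refine ((hasDerivAt_movingFrame (hasDerivAt_const y x) (hasDerivAt_id y) (hasDerivAt_const y _)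
    (hasDerivAt_const y _) (hasDerivAt_const y _) (hasDerivAt_const y _)).congr_deriv ?_).deriv
  simp

theorem formE_eq (H : IsRotational α a q) (z : ℝ × ℝ) : formE α z =
    deriv a z.1 ^ 2 + a z.1 ^ 2 + (deriv q z.1 * a z.1 + q z.1 * deriv a z.1) ^ 2 := by
  rw [formE, H.dx_eq, inner_movingFrame]
  ring

theorem formF_eq (H : IsRotational α a q) (z : ℝ × ℝ) : formF α z = 0 := by
  rw [formF, H.dx_eq, H.dy_eq, inner_movingFrame]
  ring

theorem formG_eq (H : IsRotational α a q) (z : ℝ × ℝ) : formG α z = (q z.1 * a z.1) ^ 2 := by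
  rw [formG, H.dy_eq, inner_movingFrame]
  ring

theorem area_pos (H : IsRotational α a q) (z : ℝ × ℝ) :
    0 < formE α z * formG α z - formF α z ^ 2 := by
  have := H.radius_pos z.1
  have := H.profile.pos z.1
  rw [H.formE_eq, H.formF_eq, H.formG_eq, zero_pow two_ne_zero, sub_zero]
  positivity

theorem normalPart_movingFrame (H : IsRotational α a q) (z : ℝ × ℝ) (p₁ p₂ p₃ p₄ : ℝ) :
    normalPart α z (movingFrame z.1 z.2 p₁ p₂ p₃ p₄) =
      q z.1 * a z.1 ^ 3 * (q z.1 * p₁ + deriv q z.1 * p₂ - p₃) /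
        √(formE α z * formG α z - formF α z ^ 2) := by
  rw [normalPart, H.coord_eq, H.dx_eq, H.dy_eq, det4_movingFrame]
  congr 1
  simp [Matrix.det_succ_row_zero, Fin.sum_univ_succ, Fin.succAbove]
  ring

theorem formf_eq (H : IsRotational α a q) (z : ℝ × ℝ) : formf α z = 0 := by
  rw [formf, H.dxy_eq, H.normalPart_movingFrame]
  ring

theorem formg_eq (H : IsRotational α a q) (z : ℝ × ℝ) : formg α z =
    q z.1 ^ 2 * a z.1 ^ 4 / √(formE α z * formG α z - formF α z ^ 2) := by
  rw [formg, H.dyy_eq, H.normalPart_movingFrame]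
  ring

theorem formg_pos (H : IsRotational α a q) (z : ℝ × ℝ) : 0 < formg α z := by
  have := H.radius_pos z.1
  have := H.profile.pos z.1
  rw [H.formg_eq]
  exact div_pos (by positivity) (sqrt_pos.2 (H.area_pos z))

theorem forme_eq (H : IsRotational α a q) (z : ℝ × ℝ) :
    forme α z = -(asymptoticSlope q z.1 ^ 2 * formg α z) := by
  have := (H.profile.pos z.1).ne'
  rw [H.profile.asymptoticSlope_sq, H.formg_eq, forme, H.dxx_eq, H.normalPart_movingFrame]
  field_simp
  ring

theorem disc_eq (H : IsRotational α a q) (z : ℝ × ℝ) :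
    disc α z = asymptoticSlope q z.1 * formg α z := by
  have := H.profile.asymptoticSlope_pos z.1
  have := H.formg_pos z
  rw [disc, H.formf_eq, H.forme_eq, sqrt_eq_iff_mul_self_eq_of_pos (by positivity)]
  ring

theorem isHyperbolic (H : IsRotational α a q) (z : ℝ × ℝ) : IsHyperbolic α z := by
  have := H.profile.asymptoticSlope_pos z.1
  have := H.formg_pos z
  have hneg : forme α z * formg α z < 0 := by
    rw [H.forme_eq, neg_mul, neg_lt_zero]
    positivity
  refine div_neg_of_neg_of_pos ?_ (H.area_pos z)
  rwa [H.formf_eq, zero_pow two_ne_zero, sub_zero]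

theorem mem_asymptoticLine_iff (H : IsRotational α a q) (i : Fin 2) (z w : ℝ × ℝ) :
    w ∈ asymptoticLine α i z ↔ w.2 = lineSign i * asymptoticSlope q z.1 * w.1 := by
  have hg := (H.formg_pos z).ne'
  simp only [asymptoticLine, Set.mem_ofPred_eq, H.formf_eq, H.disc_eq, H.forme_eq]
  constructor
  · rintro ⟨-, h⟩
    exact mul_left_cancel₀ hg (by linear_combination h)
  · intro h
    rw [h]
    constructor
    · linear_combination (asymptoticSlope q z.1 ^ 2 * formg α z * w.1) * lineSign_sq i
    · ring

/-- The length element `|dα/dx|` of the asymptotic lines of a torus of rotation. -/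
def asymptoticSpeed (a q : ℝ → ℝ) (x : ℝ) : ℝ :=
  √(deriv a x ^ 2 + a x ^ 2 + (deriv q x * a x + q x * deriv a x) ^ 2 +
    (q x * a x * asymptoticSlope q x) ^ 2)

theorem asymptoticSpeed_pos (H : IsRotational α a q) (x : ℝ) : 0 < asymptoticSpeed a q x := by
  have := H.radius_pos x
  exact sqrt_pos.2 (by positivity)

theorem continuous_asymptoticSpeed (H : IsRotational α a q) :
    Continuous (asymptoticSpeed a q) := by
  have ha := H.contDiff_radius.continuous
  have ha' := H.contDiff_radius.continuous_deriv one_le_two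
  have hq := H.profile.contDiff.continuous
  have hq' := H.profile.contDiff.continuous_deriv one_le_two
  have hm := H.profile.continuous_asymptoticSlope
  unfold asymptoticSpeed
  fun_prop

theorem periodic_asymptoticSpeed (H : IsRotational α a q) :
    Function.Periodic (asymptoticSpeed a q) (2 * π) := fun x => by
  simp only [asymptoticSpeed, H.periodic_radius x, H.profile.periodic x,
    periodic_deriv H.periodic_radius x, periodic_deriv H.profile.periodic x,
    H.profile.periodic_asymptoticSlope x]

theorem norm_deriv_coord (H : IsRotational α a q) {c : ℝ → ℝ × ℝ} {t : ℝ}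
    (hc : DifferentiableAt ℝ c t) {σ : ℝ} (hσ : σ ^ 2 = 1)
    (hslope : (deriv c t).2 = σ * asymptoticSlope q (c t).1 * (deriv c t).1) :
    ‖deriv (fun s => coord α (c s).1 (c s).2) t‖ =
      asymptoticSpeed a q (c t).1 * |(deriv c t).1| := by
  have hx := hasDerivAt_fst hc.hasDerivAt
  have hderiv := (hasDerivAt_movingFrame hx (hasDerivAt_snd hc.hasDerivAt)
    ((H.hasDerivAt_radius (c t).1).comp t hx) (hasDerivAt_const t 0)
    ((H.hasDerivAt_profile_mul_radius (c t).1).comp t hx) (hasDerivAt_const t 0)).deriv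
  simp only [Function.comp_apply] at hderiv
  simp only [H.coord_eq]
  rw [hderiv, asymptoticSpeed, ← sqrt_sq_eq_abs, ← sqrt_mul (by positivity),
    norm_eq_sqrt_real_inner, inner_movingFrame, hslope]
  congr 1
  linear_combination (q (c t).1 * a (c t).1 * asymptoticSlope q (c t).1 * (deriv c t).1) ^ 2 * hσ

theorem isAsymptoticLine_iff (H : IsRotational α a q) {i : Fin 2} {c : ℝ → ℝ × ℝ} :
    IsAsymptoticLine α i c ↔
      IsArclengthGraph (fun x => lineSign i * asymptoticSlope q x) (asymptoticSpeed a q) c where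
  mp hc :=
    have hslope t := (H.mem_asymptoticLine_iff i _ _).1 (hc.tangent t)
    ⟨hc.contDiff, hslope, fun t => by
      rw [← H.norm_deriv_coord (hc.contDiff.differentiable one_ne_zero t) (lineSign_sq i)
        (hslope t), hc.arclength]⟩
  mpr hc :=
    ⟨hc.contDiff, fun t => H.isHyperbolic (c t),
      fun t => (H.mem_asymptoticLine_iff i _ _).2 (hc.slope t), fun t => by
      rw [H.norm_deriv_coord (hc.hasDerivAt t).differentiableAt (lineSign_sq i) (hc.slope t),
        hc.speed]⟩

theorem exists_isAsymptoticLine (H : IsRotational α a q) (i : Fin 2) (p : Torus) :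
    ∃ c, IsAsymptoticLine α i c ∧ cover (c 0) = p := by
  obtain ⟨c, hc, hc0⟩ := IsArclengthGraph.exists_of_periodic
    (H.profile.continuous_asymptoticSlope.const_mul (lineSign i)) H.continuous_asymptoticSpeed
    two_pi_pos H.periodic_asymptoticSpeed H.asymptoticSpeed_pos
    (Complex.arg p.1, Complex.arg p.2)
  refine ⟨c, H.isAsymptoticLine_iff.2 hc, ?_⟩
  rw [hc0, cover, Circle.exp_arg, Circle.exp_arg]

theorem limitSet_eq_univ (H : IsRotational α a q)
    (hρ : Irrational (rotationNumber (asymptoticSlope q))) {i : Fin 2} {c : ℝ → ℝ × ℝ}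
    (hc : IsAsymptoticLine α i c) : limitSet (cover ∘ c) = Set.univ := by
  refine (H.isAsymptoticLine_iff.1 hc).limitSet_eq_univ
    (H.profile.continuous_asymptoticSlope.const_mul _)
    (fun x => congrArg _ (H.profile.periodic_asymptoticSlope x)) ?_ H.continuous_asymptoticSpeed
    H.periodic_asymptoticSpeed H.asymptoticSpeed_pos
  rw [rotationNumber_const_mul]
  rcases sq_eq_one_iff.1 (lineSign_sq i) with h | h
  · rwa [h, one_mul]
  · rw [h, neg_one_mul]
    exact hρ.neg

end IsRotational

section RotationalTorus

/-- The identification of `ℂ²` with `ℝ⁴`. -/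
def complexPairEquiv : (ℂ × ℂ) ≃L[ℝ] E4 :=
  LinearEquiv.toContinuousLinearEquiv
    { toFun := fun z => !₂[z.1.re, z.1.im, z.2.re, z.2.im]
      invFun := fun w => (⟨w 0, w 1⟩, ⟨w 2, w 3⟩)
      map_add' := fun z w => by
        ext i
        fin_cases i <;> simp
      map_smul' := fun r z => by
        ext i
        fin_cases i <;> simp
      left_inv := fun _ => rfl
      right_inv := fun w => by
        ext i
        fin_cases i <;> rfl }

theorem complexPairEquiv_apply (z : ℂ × ℂ) :
    complexPairEquiv z = !₂[z.1.re, z.1.im, z.2.re, z.2.im] :=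
  rfl

theorem contDiffAt_normalize {E : Type*} [NormedAddCommGroup E] [InnerProductSpace ℝ E]
    {n : WithTop ℕ∞} {v : E} (hv : v ≠ 0) : ContDiffAt ℝ n (NormedSpace.normalize : E → E) v :=
  ((contDiffAt_norm ℝ hv).inv (norm_ne_zero_iff.2 hv)).smul contDiffAt_id

theorem complexPairEquiv_ne_zero (z : Circle) (w : ℂ) : complexPairEquiv ((z : ℂ), w) ≠ 0 :=
  fun h => z.coe_ne_zero (congrArg Prod.fst (complexPairEquiv.map_eq_zero_iff.1 h))

/-- The torus of `S³` traced by the normalizations of the points `(z, Q(z) w)` of `ℂ²`, for `z` and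
`w` on the unit circle. -/
def rotationalTorus (Q : Circle → ℝ) : Torus → S3 :=
  Set.codRestrict
    (fun p : Torus => NormedSpace.normalize (complexPairEquiv ((p.1 : ℂ), Q p.1 • (p.2 : ℂ))))
    (Metric.sphere 0 1) fun p => by
      rw [mem_sphere_zero_iff_norm, NormedSpace.norm_normalize_eq_one_iff]
      exact complexPairEquiv_ne_zero p.1 _

theorem contMDiff_circle_coe : ContMDiff (𝓡 1) 𝓘(ℝ, ℂ) ∞ (fun z : Circle => (z : ℂ)) :=
  haveI := finrank_real_complex_fact'
  contMDiff_coe_sphere (E := ℂ) (n := 1)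

theorem mfderiv_circle_coe_injective (z : Circle) :
    Function.Injective (mfderiv (𝓡 1) 𝓘(ℝ, ℂ) (fun z : Circle => (z : ℂ)) z) :=
  haveI := finrank_real_complex_fact'
  injective_mvfderiv_subtypeVal_sphere (E := ℂ) (n := 1) z

theorem fact_finrank_E4 : Fact (Module.finrank ℝ E4 = 3 + 1) :=
  ⟨finrank_euclideanSpace_fin⟩

theorem contMDiff_rotationalTorus {Q : Circle → ℝ} (hQ : ContMDiff (𝓡 1) 𝓘(ℝ, ℝ) ∞ Q) :
    ContMDiff ((𝓡 1).prod (𝓡 1)) (𝓡 3) ∞ (rotationalTorus Q) := by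
  have := fact_finrank_E4
  refine ContMDiff.codRestrict_sphere (fun p => ?_) _
  have hpair : ContMDiff ((𝓡 1).prod (𝓡 1)) 𝓘(ℝ, ℂ × ℂ) ∞
      fun p : Torus => ((p.1 : ℂ), Q p.1 • (p.2 : ℂ)) :=
    (contMDiff_circle_coe.comp contMDiff_fst).prodMk_space
      ((hQ.comp contMDiff_fst).smul (contMDiff_circle_coe.comp contMDiff_snd))
  exact (contDiffAt_normalize (complexPairEquiv_ne_zero p.1 _)).contMDiffAt.comp p
    (f := fun p : Torus => complexPairEquiv ((p.1 : ℂ), Q p.1 • (p.2 : ℂ)))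
    (complexPairEquiv.contDiff.contMDiff.comp hpair p)

theorem injective_mfderiv_coe_prodMk_coe (p : Torus) :
    Function.Injective (mfderiv ((𝓡 1).prod (𝓡 1)) 𝓘(ℝ, ℂ × ℂ)
      (fun p : Torus => ((p.1 : ℂ), (p.2 : ℂ))) p) := by
  have hcoe (z : Circle) : MDifferentiableAt (𝓡 1) 𝓘(ℝ, ℂ) (fun z : Circle => (z : ℂ)) z :=
    (contMDiff_circle_coe z).mdifferentiableAt (by simp)
  have hprod := mfderiv_prodMap (hcoe p.1) (hcoe p.2)
  rw [modelWithCornersSelf_prod, ← chartedSpaceSelf_prod]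
  exact hprod ▸ (mfderiv_circle_coe_injective p.1).prodMap (mfderiv_circle_coe_injective p.2)

theorem isTorusEmbedding_of_leftInverse {α : Torus → S3}
    (hα : ContMDiff ((𝓡 1).prod (𝓡 1)) (𝓡 3) ∞ α) {g : E4 → ℂ × ℂ}
    (hg : ∀ p, DifferentiableAt ℝ g (α p)) (hgα : ∀ p, g (α p) = ((p.1 : ℂ), (p.2 : ℂ))) :
    IsTorusEmbedding α where
  smooth := hα
  immersion p v w h := by
    have := fact_finrank_E4
    have hαp : MDifferentiableAt ((𝓡 1).prod (𝓡 1)) (𝓡 3) α p :=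
      (hα p).mdifferentiableAt (by simp)
    have hgp : MDifferentiableAt (𝓡 3) 𝓘(ℝ, ℂ × ℂ) (g ∘ ((↑) : S3 → E4)) (α p) :=
      (hg p).mdifferentiableAt.comp _
        ((contMDiff_coe_sphere (m := ∞) (α p)).mdifferentiableAt (by simp))
    have hcomp : (fun p : Torus => ((p.1 : ℂ), (p.2 : ℂ))) = (g ∘ ((↑) : S3 → E4)) ∘ α :=
      funext fun p => (hgα p).symm
    apply injective_mfderiv_coe_prodMk_coe p
    rw [hcomp]
    exact (mfderiv_comp_apply p hgp hαp v).trans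
      ((congrArg _ h).trans (mfderiv_comp_apply p hgp hαp w).symm)
  embedding := by
    refine (hα.continuous.isClosedEmbedding fun p p' h => ?_).isEmbedding
    have hpp : ((p.1 : ℂ), (p.2 : ℂ)) = ((p'.1 : ℂ), (p'.2 : ℂ)) := by rw [← hgα, h, hgα]
    exact Prod.ext (Circle.ext (congrArg Prod.fst hpp)) (Circle.ext (congrArg Prod.snd hpp))

theorem isTorusEmbedding_rotationalTorus {Q : Circle → ℝ} (hQ : ContMDiff (𝓡 1) 𝓘(ℝ, ℝ) ∞ Q)
    (hpos : ∀ z, 0 < Q z) : IsTorusEmbedding (rotationalTorus Q) := by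
  have hsymm (p : Torus) : ∃ r > 0, complexPairEquiv.symm (rotationalTorus Q p) =
      (r • (p.1 : ℂ), (r * Q p.1) • (p.2 : ℂ)) := by
    refine ⟨_, inv_pos.2 (norm_pos_iff.2 (complexPairEquiv_ne_zero p.1 (Q p.1 • (p.2 : ℂ)))), ?_⟩
    rw [rotationalTorus, Set.val_codRestrict_apply, NormedSpace.normalize, map_smul,
      complexPairEquiv.symm_apply_apply, Prod.smul_mk, smul_smul]
  have hnormalize (z : Circle) {r : ℝ} (hr : 0 < r) :
      NormedSpace.normalize (r • (z : ℂ)) = z := by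
    rw [NormedSpace.normalize_smul_of_pos hr,
      NormedSpace.normalize_eq_self_of_norm_eq_one z.norm_coe]
  refine isTorusEmbedding_of_leftInverse (contMDiff_rotationalTorus hQ)
    (g := Prod.map NormedSpace.normalize NormedSpace.normalize ∘ complexPairEquiv.symm)
    (fun p => ?_) fun p => ?_ <;> obtain ⟨r, hr, hp⟩ := hsymm p
  · refine DifferentiableAt.comp _ ?_ complexPairEquiv.symm.differentiableAt
    rw [hp]
    have hfst := smul_ne_zero hr.ne' p.1.coe_ne_zero
    have hsnd := smul_ne_zero (mul_pos hr (hpos p.1)).ne' p.2.coe_ne_zero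
    refine DifferentiableAt.prodMap (p := (_, _)) ?_ ?_
    · exact (contDiffAt_normalize hfst).differentiableAt one_ne_zero
    · exact (contDiffAt_normalize hsnd).differentiableAt one_ne_zero
  · rw [Function.comp_apply, hp, Prod.map_apply, hnormalize p.1 hr,
      hnormalize p.2 (mul_pos hr (hpos p.1))]

theorem coord_rotationalTorus (Q : Circle → ℝ) (x y : ℝ) :
    coord (rotationalTorus Q) x y =
      NormedSpace.normalize (movingFrame x y 1 0 (Q (Circle.exp x)) 0) := by
  simp [coord, cover, rotationalTorus, movingFrame, complexPairEquiv_apply,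
    Complex.exp_ofReal_mul_I_re, Complex.exp_ofReal_mul_I_im]

theorem isRotational_rotationalTorus {Q : Circle → ℝ}
    (hQ : IsHyperbolicProfile fun x => Q (Circle.exp x)) :
    IsRotational (rotationalTorus Q) (fun x => (√(1 + Q (Circle.exp x) ^ 2))⁻¹)
      fun x => Q (Circle.exp x) where
  coord_eq x y := by
    rw [coord_rotationalTorus, NormedSpace.normalize, norm_eq_sqrt_real_inner, inner_movingFrame,
      smul_movingFrame, show (1 : ℝ) * 1 + 0 * 0 + Q (Circle.exp x) * Q (Circle.exp x) + 0 * 0 =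
        1 + Q (Circle.exp x) ^ 2 by ring, mul_one, mul_zero, mul_comm _ (Q _)]
  contDiff_radius :=
    ((contDiff_const.add (hQ.contDiff.pow 2)).sqrt fun x => by positivity).inv
      fun x => by positivity
  periodic_radius x := by simp only [Circle.exp_add_two_pi]
  radius_pos x := by positivity
  profile := hQ

end RotationalTorus

section CliffordDeformation

/-- The deformation function `h` in the coordinate `x = v - u`. -/
def bump (x : ℝ) : ℝ := sin (2 * x) ^ 2

/-- The ratio of the radii of the two circles of the deformed Clifford torus. -/
def cliffordProfile (ε x : ℝ) : ℝ := (1 - ε * bump x) / (1 + ε * bump x)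

/-- The function on the circle whose lift to the line is `cliffordProfile`. -/
def cliffordRatio (ε : ℝ) (z : Circle) : ℝ :=
  (1 - ε * ((z : ℂ) ^ 2).im ^ 2) / (1 + ε * ((z : ℂ) ^ 2).im ^ 2)

theorem cliffordRatio_exp (ε x : ℝ) : cliffordRatio ε (Circle.exp x) = cliffordProfile ε x := by
  have him : ((Circle.exp x : ℂ) ^ 2).im = sin (2 * x) := by
    rw [← Circle.coe_pow, ← Circle.exp_nsmul, Circle.coe_exp, Complex.exp_ofReal_mul_I_im,
      nsmul_eq_mul, Nat.cast_ofNat]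
  rw [cliffordRatio, him, cliffordProfile, bump]

theorem bump_mem_Icc (x : ℝ) : bump x ∈ Set.Icc (0 : ℝ) 1 := ⟨sq_nonneg _, sin_sq_le_one _⟩

theorem hasDerivAt_bump (x : ℝ) : HasDerivAt bump (2 * sin (4 * x)) x := by
  refine ((((hasDerivAt_id x).const_mul 2).sin).pow 2).congr_deriv ?_
  rw [show 4 * x = 2 * (2 * x) by ring, sin_two_mul (2 * x)]
  simp only [id]
  ring

variable {ε : ℝ}

theorem one_add_mul_bump_pos (hε : 0 ≤ ε) (x : ℝ) : 0 < 1 + ε * bump x :=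
  add_pos_of_pos_of_nonneg one_pos (mul_nonneg hε (bump_mem_Icc x).1)

theorem mul_bump_le (hε : ε ∈ Set.Icc (0 : ℝ) (1 / 100)) (x : ℝ) : ε * bump x ≤ 1 / 100 :=
  (mul_le_of_le_one_right hε.1 (bump_mem_Icc x).2).trans hε.2

theorem contDiff_cliffordProfile (hε : 0 ≤ ε) : ContDiff ℝ 2 (cliffordProfile ε) := by
  unfold cliffordProfile
  have hbump : ContDiff ℝ 2 bump := by
    unfold bump
    fun_prop
  exact ContDiff.div (by fun_prop) (by fun_prop) fun x => (one_add_mul_bump_pos hε x).ne'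

theorem deriv_cliffordProfile (hε : 0 ≤ ε) (x : ℝ) :
    deriv (cliffordProfile ε) x = -(4 * ε * sin (4 * x)) / (1 + ε * bump x) ^ 2 := by
  have hk := (hasDerivAt_bump x).const_mul ε
  refine (((hk.const_sub 1).div (hk.const_add 1)
    (one_add_mul_bump_pos hε x).ne').congr_deriv ?_).deriv
  ring

theorem deriv_deriv_cliffordProfile (hε : 0 ≤ ε) (x : ℝ) :
    deriv (deriv (cliffordProfile ε)) x =
      (16 * ε ^ 2 * sin (4 * x) ^ 2 - 16 * ε * cos (4 * x) * (1 + ε * bump x)) /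
        (1 + ε * bump x) ^ 3 := by
  have hpos := (one_add_mul_bump_pos hε x).ne'
  rw [funext (deriv_cliffordProfile hε)]
  refine ((((((hasDerivAt_id x).const_mul 4).sin.const_mul (4 * ε)).neg).div
    ((((hasDerivAt_bump x).const_mul ε).const_add 1).pow 2)
    (pow_ne_zero 2 hpos)).congr_deriv ?_).deriv
  simp only [id, Pi.pow_apply, Pi.neg_apply]
  field_simp
  ring

theorem cliffordProfile_pos (hε : ε ∈ Set.Icc (0 : ℝ) (1 / 100)) (x : ℝ) :
    0 < cliffordProfile ε x :=
  div_pos (by linarith [mul_bump_le hε x]) (one_add_mul_bump_pos hε.1 x)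

theorem isHyperbolicProfile_cliffordProfile (hε : ε ∈ Set.Icc (0 : ℝ) (1 / 100)) :
    IsHyperbolicProfile (cliffordProfile ε) where
  contDiff := contDiff_cliffordProfile hε.1
  periodic x := by simp only [← cliffordRatio_exp, Circle.exp_add_two_pi]
  pos := cliffordProfile_pos hε
  convex x := by
    have hpos := one_add_mul_bump_pos hε.1 x
    have hk := mul_bump_le hε x
    have hk0 : 0 ≤ ε * bump x := mul_nonneg hε.1 (bump_mem_Icc x).1
    have hcos : ε * cos (4 * x) ≤ 1 / 100 :=
      (mul_le_of_le_one_right hε.1 (cos_le_one _)).trans hε.2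
    have hbracket : 0 < 1 - (ε * bump x) ^ 2 - 16 * (ε * cos (4 * x)) := by nlinarith
    calc 0 < (16 * ε ^ 2 * sin (4 * x) ^ 2 +
          (1 + ε * bump x) * (1 - (ε * bump x) ^ 2 - 16 * (ε * cos (4 * x)))) /
            (1 + ε * bump x) ^ 3 := by positivity
      _ = deriv (deriv (cliffordProfile ε)) x + cliffordProfile ε x := by
        rw [deriv_deriv_cliffordProfile hε.1, cliffordProfile]
        field_simp
        ring

theorem asymptoticSlope_cliffordProfile (hε : ε ∈ Set.Icc (0 : ℝ) (1 / 100)) (x : ℝ) :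
    asymptoticSlope (cliffordProfile ε) x =
      √((16 * ε ^ 2 * sin (4 * x) ^ 2 - 16 * ε * cos (4 * x) * (1 + ε * bump x)) /
        (1 + ε * bump x) ^ 3 / cliffordProfile ε x + 1) := by
  rw [asymptoticSlope, deriv_deriv_cliffordProfile hε.1, add_div,
    div_self (cliffordProfile_pos hε x).ne']

theorem continuousOn_rotationNumber_cliffordProfile :
    ContinuousOn (fun ε => rotationNumber (asymptoticSlope (cliffordProfile ε)))
      (Set.Icc 0 (1 / 100)) := by
  rw [continuousOn_iff_continuous_domRestrict]
  refine (intervalIntegral.continuous_parametric_intervalIntegral_of_continuous'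
    (f := fun (ε : Set.Icc (0 : ℝ) (1 / 100)) x => asymptoticSlope (cliffordProfile ε) x)
    ?_ 0 (2 * π)).div_const _
  simp only [Function.uncurry_def, asymptoticSlope_cliffordProfile (Subtype.prop _)]
  have hbump : Continuous fun z : Set.Icc (0 : ℝ) (1 / 100) × ℝ => bump z.2 := by
    unfold bump
    fun_prop
  have hprofile : Continuous fun z : Set.Icc (0 : ℝ) (1 / 100) × ℝ => cliffordProfile z.1 z.2 :=
    Continuous.div (by fun_prop) (by fun_prop) fun z => (one_add_mul_bump_pos z.1.2.1 z.2).ne'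
  have hderiv : Continuous fun z : Set.Icc (0 : ℝ) (1 / 100) × ℝ =>
      (16 * (z.1 : ℝ) ^ 2 * sin (4 * z.2) ^ 2 -
        16 * z.1 * cos (4 * z.2) * (1 + z.1 * bump z.2)) / (1 + z.1 * bump z.2) ^ 3 :=
    Continuous.div (by fun_prop) (by fun_prop)
      fun z => (pow_pos (one_add_mul_bump_pos z.1.2.1 z.2) 3).ne'
  exact ((hderiv.div hprofile fun z => (cliffordProfile_pos z.1.2 z.2).ne').add
    continuous_const).sqrt

theorem rotationNumber_cliffordProfile_zero :
    rotationNumber (asymptoticSlope (cliffordProfile 0)) = 1 := by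
  have hslope : asymptoticSlope (cliffordProfile 0) = fun _ => 1 := funext fun x => by
    rw [asymptoticSlope_cliffordProfile ⟨le_rfl, by norm_num⟩]
    simp
  rw [hslope, rotationNumber, intervalIntegral.integral_const, smul_eq_mul, mul_one, sub_zero,
    div_self two_pi_pos.ne']

theorem integral_cos_natCast_mul {n : ℕ} (hn : n ≠ 0) : ∫ x in 0..2 * π, cos (n * x) = 0 := by
  rw [intervalIntegral.integral_comp_mul_left _ (Nat.cast_ne_zero.2 hn), integral_cos,
    sin_periodic.nat_mul_eq, mul_zero, sub_self, smul_zero]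

theorem sq_sub_inv_sub_sq_deriv_cliffordProfile_le (hε : ε ∈ Set.Icc (0 : ℝ) (1 / 100)) (x : ℝ) :
    (cliffordProfile ε x - (cliffordProfile ε x)⁻¹) ^ 2 - deriv (cliffordProfile ε) x ^ 2 ≤
      ε ^ 2 * (17 * bump x ^ 2 - 14 * sin (4 * x) ^ 2) := by
  have hpos := one_add_mul_bump_pos hε.1 x
  have hk := mul_bump_le hε x
  have hk0 : 0 ≤ ε * bump x := mul_nonneg hε.1 (bump_mem_Icc x).1
  have hsub : 0 < 1 - ε * bump x := by linarith
  have hsq : (cliffordProfile ε x - (cliffordProfile ε x)⁻¹) ^ 2 ≤ 17 * (ε * bump x) ^ 2 := by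
    have hdenom : 16 / 17 ≤ ((1 + ε * bump x) * (1 - ε * bump x)) ^ 2 := by
      have hk2 : (ε * bump x) ^ 2 ≤ (1 / 100) ^ 2 := pow_le_pow_left₀ hk0 hk 2
      nlinarith [sq_nonneg ((ε * bump x) ^ 2)]
    calc (cliffordProfile ε x - (cliffordProfile ε x)⁻¹) ^ 2
        = 16 * (ε * bump x) ^ 2 / ((1 + ε * bump x) * (1 - ε * bump x)) ^ 2 := by
          rw [cliffordProfile]
          field_simp
          ring
      _ ≤ 17 * (ε * bump x) ^ 2 := by
          rw [div_le_iff₀ (by positivity)]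
          nlinarith [sq_nonneg (ε * bump x)]
  have hderiv : 14 * (ε * sin (4 * x)) ^ 2 ≤ deriv (cliffordProfile ε) x ^ 2 := by
    have hdenom : (1 + ε * bump x) ^ 4 ≤ 8 / 7 := by
      calc (1 + ε * bump x) ^ 4 ≤ (1 + 1 / 100) ^ 4 := by gcongr
        _ ≤ 8 / 7 := by norm_num
    calc 14 * (ε * sin (4 * x)) ^ 2
        ≤ 16 * (ε * sin (4 * x)) ^ 2 / (1 + ε * bump x) ^ 4 := by
          rw [le_div_iff₀ (pow_pos hpos 4)]
          nlinarith [sq_nonneg (ε * sin (4 * x))]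
      _ = deriv (cliffordProfile ε) x ^ 2 := by
          rw [deriv_cliffordProfile hε.1]
          field_simp
          ring
  linarith

theorem integral_bump_sq_sub_sin_sq :
    ∫ x in 0..2 * π, (17 * bump x ^ 2 - 14 * sin (4 * x) ^ 2) = -(5 / 4 * π) := by
  have hfourier (x : ℝ) : 17 * bump x ^ 2 - 14 * sin (4 * x) ^ 2 =
      -(5 / 8) - 17 / 2 * cos ((4 : ℕ) * x) + 73 / 8 * cos ((8 : ℕ) * x) := by
    have hcos4 : cos (4 * x) = 1 - 2 * bump x := by
      rw [show 4 * x = 2 * (2 * x) by ring, cos_two_mul', cos_sq', bump]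
      ring
    have hcos8 : cos (8 * x) = 1 - 2 * sin (4 * x) ^ 2 := by
      rw [show 8 * x = 2 * (4 * x) by ring, cos_two_mul', cos_sq']
      ring
    have := sin_sq_add_cos_sq (4 * x)
    rw [hcos4] at this
    push_cast
    rw [hcos4, hcos8]
    linear_combination (17 / 4) * this
  have hint (n : ℕ) (c : ℝ) :
      IntervalIntegrable (fun x => c * cos (n * x)) MeasureTheory.volume 0 (2 * π) :=
    Continuous.intervalIntegrable (by fun_prop) _ _
  simp only [hfourier]
  rw [intervalIntegral.integral_add (intervalIntegrable_const.sub (hint 4 _)) (hint 8 _),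
    intervalIntegral.integral_sub intervalIntegrable_const (hint 4 _),
    intervalIntegral.integral_const_mul, intervalIntegral.integral_const_mul,
    integral_cos_natCast_mul four_ne_zero, integral_cos_natCast_mul (by norm_num),
    intervalIntegral.integral_const, smul_eq_mul]
  ring

theorem rotationNumber_cliffordProfile_lt_one (hε : ε ∈ Set.Ioc (0 : ℝ) (1 / 100)) :
    rotationNumber (asymptoticSlope (cliffordProfile ε)) < 1 := by
  have hmem := Set.Ioc_subset_Icc_self hε
  have H := isHyperbolicProfile_cliffordProfile hmem
  refine H.rotationNumber_lt_one ?_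
  have hsq : Continuous fun x => (cliffordProfile ε x - (cliffordProfile ε x)⁻¹) ^ 2 :=
    (H.contDiff.continuous.sub (H.contDiff.continuous.inv₀ fun x => (H.pos x).ne')).pow 2
  have hderiv : Continuous fun x => deriv (cliffordProfile ε) x ^ 2 :=
    (H.contDiff.continuous_deriv one_le_two).pow 2
  have hbound : Continuous fun x => ε ^ 2 * (17 * bump x ^ 2 - 14 * sin (4 * x) ^ 2) := by
    unfold bump
    fun_prop
  rw [← sub_neg, ← intervalIntegral.integral_sub (hsq.intervalIntegrable _ _)
    (hderiv.intervalIntegrable _ _)]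
  calc _ ≤ ∫ x in 0..2 * π, ε ^ 2 * (17 * bump x ^ 2 - 14 * sin (4 * x) ^ 2) :=
        intervalIntegral.integral_mono two_pi_pos.le ((hsq.sub hderiv).intervalIntegrable _ _)
          (hbound.intervalIntegrable _ _) (sq_sub_inv_sub_sq_deriv_cliffordProfile_le hmem)
    _ = -(ε ^ 2 * (5 / 4 * π)) := by
        rw [intervalIntegral.integral_const_mul, integral_bump_sq_sub_sin_sq, mul_neg]
    _ < 0 := neg_lt_zero.2 (mul_pos (pow_pos hε.1 2) (by positivity))

theorem exists_irrational_rotationNumber_cliffordProfile {δ : ℝ} (hδ : 0 < δ) :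
    ∃ ε ∈ Set.Ioc (0 : ℝ) (1 / 100), ε < δ ∧
      Irrational (rotationNumber (asymptoticSlope (cliffordProfile ε))) := by
  obtain ⟨η, hη0, hη⟩ := exists_between (lt_min hδ (by norm_num : (0 : ℝ) < 1 / 100))
  obtain ⟨hηδ, hη1⟩ := lt_min_iff.1 hη
  obtain ⟨ρ, hρ, hρη, hρ1⟩ :=
    exists_irrational_btwn (rotationNumber_cliffordProfile_lt_one ⟨hη0, hη1.le⟩)
  obtain ⟨ε, hε, rfl⟩ := intermediate_value_Icc' hη0.le
    (continuousOn_rotationNumber_cliffordProfile.mono (Set.Icc_subset_Icc_right hη1.le))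
    ⟨hρη.le, rotationNumber_cliffordProfile_zero.symm ▸ hρ1.le⟩
  refine ⟨ε, ⟨hε.1.lt_of_ne ?_, hε.2.trans hη1.le⟩, hε.2.trans_lt hηδ, hρ⟩
  rintro rfl
  exact hρ1.ne rotationNumber_cliffordProfile_zero

theorem contMDiff_cliffordRatio (hε : 0 ≤ ε) :
    ContMDiff (𝓡 1) 𝓘(ℝ, ℝ) ∞ (cliffordRatio ε) := by
  have him : ContDiff ℝ ∞ fun w : ℂ => (w ^ 2).im :=
    Complex.imCLM.contDiff.comp (contDiff_id.pow 2)
  have hratio : ContDiff ℝ ∞ fun w : ℂ => (1 - ε * (w ^ 2).im ^ 2) / (1 + ε * (w ^ 2).im ^ 2) :=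
    ContDiff.div (by fun_prop) (by fun_prop) fun w => by positivity
  exact hratio.contMDiff.comp contMDiff_circle_coe

theorem cliffordRatio_pos (hε : ε ∈ Set.Icc (0 : ℝ) (1 / 100)) (z : Circle) :
    0 < cliffordRatio ε z := by
  rw [← Circle.exp_arg z, cliffordRatio_exp]
  exact cliffordProfile_pos hε _

theorem isTorusEmbedding_cliffordRatio (hε : ε ∈ Set.Icc (0 : ℝ) (1 / 100)) :
    IsTorusEmbedding (rotationalTorus (cliffordRatio ε)) :=
  isTorusEmbedding_rotationalTorus (contMDiff_cliffordRatio hε.1) (cliffordRatio_pos hε)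

theorem rotationalTorus_cliffordRatio_cover (hε : 0 ≤ ε) (u v : ℝ) :
    (rotationalTorus (cliffordRatio ε) (cover (-u + v, u + v)) : E4) =
      Clifford.deformation ε u v := by
  have hpos := one_add_mul_bump_pos hε (-u + v)
  have hh : Clifford.h u v = bump (-u + v) := by
    rw [Clifford.h, bump, show 2 * v - 2 * u = 2 * (-u + v) by ring]
  have hscale : Clifford.C u v + (ε * Clifford.h u v) • Clifford.N u v =
      (√2 / 2 * (1 + ε * bump (-u + v))) •
        movingFrame (-u + v) (u + v) 1 0 (cliffordProfile ε (-u + v)) 0 := by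
    rw [hh, cliffordProfile]
    ext i
    fin_cases i <;> simp [Clifford.C, Clifford.N, movingFrame] <;> field_simp <;> ring
  change coord _ _ _ = NormedSpace.normalize _
  rw [coord_rotationalTorus, cliffordRatio_exp, hscale,
    NormedSpace.normalize_smul_of_pos (by positivity)]

theorem isRotational_cliffordRatio (hε : ε ∈ Set.Icc (0 : ℝ) (1 / 100)) :
    IsRotational (rotationalTorus (cliffordRatio ε))
      (fun x => (√(1 + cliffordProfile ε x ^ 2))⁻¹) (cliffordProfile ε) := by
  have H := isRotational_rotationalTorus (Q := cliffordRatio ε)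
  simp only [cliffordRatio_exp] at H
  exact H (isHyperbolicProfile_cliffordProfile hε)

end CliffordDeformation

end

theorem theorem1 (δ : ℝ) (hδ : 0 < δ) :
    ∃ ε : ℝ, ε ≠ 0 ∧ |ε| < δ ∧ ∃ α : Torus → S3,
      IsTorusEmbedding α ∧
      (∀ u v : ℝ, (α (cover (-u + v, u + v)) : E4) = Clifford.deformation ε u v) ∧
      (∀ q : ℝ × ℝ, TorusMap.IsHyperbolic α q) ∧
      ∀ i : Fin 2,
        (∀ p : Torus, ∃ c : ℝ → ℝ × ℝ, TorusMap.IsAsymptoticLine α i c ∧ cover (c 0) = p) ∧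
        ∀ c : ℝ → ℝ × ℝ, TorusMap.IsAsymptoticLine α i c →
          Dense (Set.range (cover ∘ c)) ∧ TorusMap.limitSet (cover ∘ c) = Set.univ := by
  obtain ⟨ε, hε, hlt, hρ⟩ := exists_irrational_rotationNumber_cliffordProfile hδ
  have hmem := Set.Ioc_subset_Icc_self hε
  have H := isRotational_cliffordRatio hmem
  refine ⟨ε, hε.1.ne', by rwa [abs_of_pos hε.1], rotationalTorus (cliffordRatio ε),
    isTorusEmbedding_cliffordRatio hmem, rotationalTorus_cliffordRatio_cover hε.1.le,
    H.isHyperbolic, fun i => ⟨H.exists_isAsymptoticLine i, fun c hc => ?_⟩⟩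
  have hlimit := H.limitSet_eq_univ hρ hc
  exact ⟨dense_range_of_limitSet_eq_univ hlimit, hlimit⟩
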